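/- **Conventions.** All graphs are finite and simple. Fix one of two matrix representations of graphs, the adjacency matrix $A$ or the Laplacian matrix $L=D-A$; the spectrum of a graph is the multiset of eigenvalues, with multiplicity, of the chosen matrix. Two graphs are *cospectral* if they have the same spectrum and are not isomorphic. An indexed family of graphs is a *connected cospectral family* if each of its members is connected and any two members with different indices are cospectral. $G\square H$ denotes the Cartesian product. A graph $P$ is a *(Cartesian) factor* of $G$ if $G\cong P\square Q$ for some graph $Q$. A graph is *trivial* if it has exactly one vertex; a graph $G$ is *Cartesian prime* if it has more than one vertex and its only nontrivial factor, up to isomorphism, is $G$ itself. **Theorem 1.** Let $\mathcal G=\{G_1,\dots,G_p\}$ and $\mathcal H=\{H_1,\dots,H_q\}$ be connected cospectral families such that, for all $i,j$, the spectrum of $G_i$ is different from the spectrum of $H_j$. Suppose that at least one of the following conditions holds: 1. every graph in $\mathcal G\cup\mathcal H$ is Cartesian prime; 2. $\gcd(|V(G)|,|V(H)|)=1$ for all $G\in\mathcal G$ and $H\in\mathcal H$; 3. no Cartesian prime graph $P$ is a common factor of any $G\in\mathcal G$ and $H\in\mathcal H$. Then the family $\mathcal F=\{G_i\square H_j : 1\le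 i\le p,\ 1\le j\le q\}$ is a connected cospectral family: all the graphs $G_i\square H_j$ are connected, they all have the same spectrum, and $G_i\square H_j\not\cong G_k\square H_l$ whenever $(i,j)\ne(k,l)$. In particular $\mathcal F$ consists of $pq$ pairwise non-isomorphic graphs. -/

import Mathlib

namespace SimpleGraph

/-- The two matrix representations of a graph with respect to which spectra are taken. -/
inductive MatrixRep where
  | adjacency
  | laplacian

open Classical in
/-- The real matrix of a finite graph: its adjacency matrix `A` or its Laplacian `D - A`. -/
noncomputable def repMatrix {V : Type*} [Fintype V] (M : MatrixRep) (G : SimpleGraph V) :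
    Matrix V V ℝ :=
  match M with
  | .adjacency => G.adjMatrix ℝ
  | .laplacian => G.lapMatrix ℝ

open Classical in
/-- The spectrum of a finite graph: the multiset of eigenvalues of its (real symmetric) matrix,
counted with multiplicity, i.e. the roots of the characteristic polynomial. -/
noncomputable def graphSpectrum {V : Type*} [Fintype V] (M : MatrixRep) (G : SimpleGraph V) :
    Multiset ℝ :=
  (repMatrix M G).charpoly.roots

/-- Two graphs are cospectral if they have the same spectrum and are not isomorphic. -/
def Cospectral {V W : Type*} [Fintype V] [Fintype W] (M : MatrixRep)
    (G : SimpleGraph V) (H : SimpleGraph W) : Prop :=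
  graphSpectrum M G = graphSpectrum M H ∧ ¬ Nonempty (G ≃g H)

/-- A family of connected graphs any two of whose members (at different indices) are cospectral;
in particular the members are pairwise non-isomorphic. -/
def IsConnectedCospectralFamily {ι : Type*} {V : ι → Type*} [∀ i, Fintype (V i)]
    (M : MatrixRep) (G : ∀ i, SimpleGraph (V i)) : Prop :=
  (∀ i, (G i).Connected) ∧ Pairwise fun i j => Cospectral M (G i) (G j)

/-- `P` is a Cartesian factor of the finite graph `G`: `G ≅ P □ Q` for some finite graph `Q`
(taken, up to isomorphism, on some `Fin n`). Since `□` is commutative and associative up to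
isomorphism and `Q` may have a single vertex, this covers the factors of factorizations
of any length. -/
def IsCartesianFactor {U V : Type*} [Finite V] (P : SimpleGraph U) (G : SimpleGraph V) : Prop :=
  ∃ (n : ℕ) (Q : SimpleGraph (Fin n)), Nonempty (G ≃g P □ Q)

/-- A finite graph is Cartesian prime if it is nontrivial (has more than one vertex) and,
up to isomorphism, its only nontrivial Cartesian factor is itself. Factors are taken,
up to isomorphism, on some `Fin m`. -/
def IsCartesianPrime {V : Type*} [Finite V] (G : SimpleGraph V) : Prop :=
  Nontrivial V ∧
    ∀ (m : ℕ) (P : SimpleGraph (Fin m)), P.IsCartesianFactor G → m = 1 ∨ Nonempty (P ≃g G)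

end SimpleGraph

/-!
The spectrum of a Cartesian product is the multiset of sums of eigenvalues of the two factors: the
matrix of `G □ H` is the Kronecker sum of the matrices of `G` and `H`, and a Kronecker sum of
diagonalizable matrices is diagonalized by the Kronecker product of the diagonalizing matrices
(`graphSpectrum_boxProd`). Hence all the products `G i □ H j` have the same spectrum, and they are
connected because their factors are.

That the products are pairwise non-isomorphic rests on a common refinement of any two factorizations
`A □ B ≃ C □ D` of a connected graph (`exists_boxProd_refinement`): there are graphs with
`A ≃ A₁ □ A₂`, `B ≃ B₁ □ B₂`, `C ≃ A₁ □ B₁` and `D ≃ A₂ □ B₂`. The reason is metric. Distances in a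
Cartesian product are sums of distances in the factors, so that the corner `(c, d')` lies on a
geodesic from `(c, d)` to `(c', d')`; and the layers of a product are convex. So the image of a layer
of `A □ B` in `C □ D`, which is convex, contains the corners spanned by its points and is therefore
the product of two induced subgraphs (`layerIso`). The parts obtained from the layers of `A □ B` and
from those of `C □ D` agree (`induceLayerIso`).

If `G i □ H j ≃ G k □ H l`, the refinement makes `A₂` a common factor of `G i` and `H l`, and `B₁` a
common factor of `H j` and `G k`. When these are both trivial, `G i ≃ A₁ ≃ G k` and
`H j ≃ B₂ ≃ H l`. They are trivial if no prime graph is a common factor, because every nontrivial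
finite graph has a prime factor; coprime orders exclude a common prime factor; and if all graphs are
prime, then a common prime factor of `G i` and `H l` would be isomorphic to both, against the
hypothesis on the spectra.
-/

namespace SimpleGraph

open Matrix Polynomial
open scoped Kronecker

/-! ### The spectrum of a Cartesian product -/

theorem exists_diagonalization {m : Type*} [Fintype m] [DecidableEq m] {A : Matrix m m ℝ}
    (hA : A.IsHermitian) :
    ∃ (P Q : Matrix m m ℝ) (d : m → ℝ), Q * P = 1 ∧ A = P * diagonal d * Q ∧
      A.charpoly.roots = Finset.univ.val.map d := by
  refine ⟨hA.eigenvectorUnitary, star (hA.eigenvectorUnitary : Matrix m m ℝ), hA.eigenvalues,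
    by simp, ?_, ?_⟩
  · have h := hA.spectral_theorem
    rwa [Unitary.conjStarAlgAut_apply] at h
  · exact hA.roots_charpoly_eq_eigenvalues

theorem roots_charpoly_kroneckerSum {m n : Type*} [Fintype m] [DecidableEq m] [Fintype n]
    [DecidableEq n] {A : Matrix m m ℝ} {B : Matrix n n ℝ} (hA : A.IsHermitian)
    (hB : B.IsHermitian) :
    (A ⊗ₖ (1 : Matrix n n ℝ) + (1 : Matrix m m ℝ) ⊗ₖ B).charpoly.roots =
      (A.charpoly.roots ×ˢ B.charpoly.roots).map fun x => x.1 + x.2 := by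
  obtain ⟨P, Q, d, hQP, hAd, hAr⟩ := exists_diagonalization hA
  obtain ⟨P', Q', d', hQP', hBd, hBr⟩ := exists_diagonalization hB
  have hPQ : P * Q = 1 := mul_eq_one_comm.mp hQP
  have hPQ' : P' * Q' = 1 := mul_eq_one_comm.mp hQP'
  have key : A ⊗ₖ (1 : Matrix n n ℝ) + (1 : Matrix m m ℝ) ⊗ₖ B =
      (P ⊗ₖ P') * (diagonal (fun x : m × n => d x.1 + d' x.2) * (Q ⊗ₖ Q')) := by
    have hdiag : diagonal (fun x : m × n => d x.1 + d' x.2) =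
        diagonal d ⊗ₖ (1 : Matrix n n ℝ) + (1 : Matrix m m ℝ) ⊗ₖ diagonal d' := by
      rw [← diagonal_one, ← diagonal_one, diagonal_kronecker_diagonal,
        diagonal_kronecker_diagonal, diagonal_add]
      simp
    rw [hdiag, add_mul, mul_add, ← mul_kronecker_mul, ← mul_kronecker_mul, ← mul_kronecker_mul,
      ← mul_kronecker_mul, one_mul, one_mul, hPQ, hPQ', ← mul_assoc, ← mul_assoc, ← hAd, ← hBd]
  have hQPk : (Q ⊗ₖ Q') * (P ⊗ₖ P') = 1 := by
    rw [← mul_kronecker_mul, hQP, hQP', one_kronecker_one]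
  rw [key, charpoly_mul_comm, mul_assoc, hQPk, mul_one, charpoly_diagonal, hAr, hBr,
    roots_prod _ _ (Finset.prod_ne_zero_iff.mpr fun _ _ => X_sub_C_ne_zero _)]
  simp only [roots_X_sub_C, Multiset.bind_singleton]
  have hprod : (Finset.univ : Finset (m × n)).val =
      (Finset.univ : Finset m).val ×ˢ (Finset.univ : Finset n).val := rfl
  rw [hprod]
  simp [SProd.sprod, Multiset.product, Multiset.map_bind, Multiset.bind_map]

theorem isHermitian_repMatrix {V : Type*} [Fintype V] (M : MatrixRep) (G : SimpleGraph V) :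
    (repMatrix M G).IsHermitian := by
  classical
  cases M
  · exact G.isHermitian_adjMatrix (R := ℝ)
  · exact G.isHermitian_lapMatrix (R := ℝ)

open Classical in
theorem adjMatrix_boxProd {V W : Type*} (G : SimpleGraph V) (H : SimpleGraph W) :
    (G □ H).adjMatrix ℝ =
      G.adjMatrix ℝ ⊗ₖ (1 : Matrix W W ℝ) + (1 : Matrix V V ℝ) ⊗ₖ H.adjMatrix ℝ := by
  ext ⟨a, b⟩ ⟨a', b'⟩
  by_cases ha : a = a' <;> by_cases hb : b = b' <;>
    simp [adjMatrix_apply, one_apply, kroneckerMap_apply, ha, hb]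

open Classical in
theorem degMatrix_boxProd {V W : Type*} [Fintype V] [Fintype W]
    (G : SimpleGraph V) (H : SimpleGraph W) :
    (G □ H).degMatrix ℝ =
      G.degMatrix ℝ ⊗ₖ (1 : Matrix W W ℝ) + (1 : Matrix V V ℝ) ⊗ₖ H.degMatrix ℝ := by
  ext ⟨a, b⟩ ⟨a', b'⟩
  by_cases ha : a = a' <;> by_cases hb : b = b' <;>
    simp [degMatrix, degree_boxProd, one_apply, kroneckerMap_apply, ha, hb]

open Classical in
theorem lapMatrix_boxProd {V W : Type*} [Fintype V] [Fintype W]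
    (G : SimpleGraph V) (H : SimpleGraph W) :
    (G □ H).lapMatrix ℝ =
      G.lapMatrix ℝ ⊗ₖ (1 : Matrix W W ℝ) + (1 : Matrix V V ℝ) ⊗ₖ H.lapMatrix ℝ := by
  rw [lapMatrix, degMatrix_boxProd, adjMatrix_boxProd]
  ext ⟨a, b⟩ ⟨a', b'⟩
  simp only [lapMatrix, Matrix.sub_apply, Matrix.add_apply, kroneckerMap_apply]
  ring

open Classical in
/-- The matrix of a Cartesian product is the Kronecker sum of the matrices of the factors. -/
theorem repMatrix_boxProd {V W : Type*} [Fintype V] [Fintype W] (M : MatrixRep)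
    (G : SimpleGraph V) (H : SimpleGraph W) :
    repMatrix M (G □ H) =
      repMatrix M G ⊗ₖ (1 : Matrix W W ℝ) + (1 : Matrix V V ℝ) ⊗ₖ repMatrix M H := by
  cases M
  · exact adjMatrix_boxProd G H
  · simp only [repMatrix]
    convert lapMatrix_boxProd G H

theorem graphSpectrum_boxProd {V W : Type*} [Fintype V] [Fintype W] (M : MatrixRep)
    (G : SimpleGraph V) (H : SimpleGraph W) :
    graphSpectrum M (G □ H) =
      (graphSpectrum M G ×ˢ graphSpectrum M H).map fun x => x.1 + x.2 := by
  classical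
  have h := roots_charpoly_kroneckerSum (isHermitian_repMatrix M G) (isHermitian_repMatrix M H)
  rw [← repMatrix_boxProd] at h
  unfold graphSpectrum
  convert h

theorem Iso.graphSpectrum_eq {V W : Type*} [Fintype V] [Fintype W] (M : MatrixRep)
    {G : SimpleGraph V} {H : SimpleGraph W} (e : G ≃g H) :
    graphSpectrum M G = graphSpectrum M H := by
  classical
  have hadj : ∀ x y, G.Adj (e.symm x) (e.symm y) ↔ H.Adj x y := fun x y => e.symm.map_adj_iff
  have hdeg : ∀ x, G.degree (e.symm x) = H.degree x := fun x => e.symm.degree_eq x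
  have h : repMatrix M H = (repMatrix M G).reindex e.toEquiv e.toEquiv := by
    ext x y
    change _ = repMatrix M G (e.symm x) (e.symm y)
    cases M
    · simp [repMatrix, adjMatrix_apply, hadj]
    · simp [repMatrix, lapMatrix, degMatrix, diagonal_apply, adjMatrix_apply, hadj, hdeg]
  unfold graphSpectrum
  rw [h, charpoly_reindex]

/-! ### Common refinement of two factorizations -/

section Refinement

variable {α β γ δ : Type*} {A : SimpleGraph α} {B : SimpleGraph β} {C : SimpleGraph γ}
  {D : SimpleGraph δ}

/-- The Cartesian product of two graph isomorphisms. -/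
def Iso.boxProd (e : A ≃g C) (f : B ≃g D) : (A □ B) ≃g (C □ D) where
  toEquiv := Equiv.prodCongr e.toEquiv f.toEquiv
  map_rel_iff' := by
    rintro ⟨a, b⟩ ⟨a', b'⟩
    change C.Adj (e a) (e a') ∧ f b = f b' ∨ D.Adj (f b) (f b') ∧ e a = e a' ↔ _
    rw [e.map_adj_iff, f.map_adj_iff, e.injective.eq_iff, f.injective.eq_iff, boxProd_adj]

theorem Hom.edist_le (f : A →g C) (x y : α) : C.edist (f x) (f y) ≤ A.edist x y := by
  refine le_iInf fun w => ?_
  simpa using SimpleGraph.edist_le (w.map f)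

theorem Iso.edist_eq (e : A ≃g C) (x y : α) : C.edist (e x) (e y) = A.edist x y := by
  refine le_antisymm (Hom.edist_le e.toHom x y) ?_
  simpa using Hom.edist_le e.symm.toHom (e x) (e y)

/-- Layers are convex: `(c, d')` lies on a geodesic from `(c, d)` to `(c', d')`, so if an isomorphism
to `A □ B` maps the ends of this geodesic into one `A`-layer, it maps the corner into it too. -/
theorem Iso.snd_eq_of_corner (ψ : (C □ D) ≃g (A □ B)) (hA : A.Preconnected) {c c' : γ} {d d' : δ}
    (h : (ψ (c, d)).2 = (ψ (c', d')).2) : (ψ (c, d')).2 = (ψ (c, d)).2 := by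
  have h1 := Iso.edist_eq ψ (c, d) (c, d')
  have h2 := Iso.edist_eq ψ (c, d') (c', d')
  have h3 := Iso.edist_eq ψ (c, d) (c', d')
  rw [edist_boxProd, edist_boxProd] at h1 h2 h3
  simp only [edist_self, zero_add, add_zero, h] at h1 h2 h3
  rw [← h1, ← h2] at h3
  have ht := A.edist_triangle (u := (ψ (c, d)).1) (v := (ψ (c, d')).1) (w := (ψ (c', d')).1)
  have f1 : A.edist (ψ (c, d)).1 (ψ (c, d')).1 ≠ ⊤ := edist_ne_top_iff_reachable.mpr (hA _ _)
  have f2 : A.edist (ψ (c, d')).1 (ψ (c', d')).1 ≠ ⊤ := edist_ne_top_iff_reachable.mpr (hA _ _)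
  have hz : B.edist (ψ (c', d')).2 (ψ (c, d')).2 = 0 := by
    rw [h3, B.edist_comm (u := (ψ (c, d')).2)] at ht
    lift A.edist (ψ (c, d)).1 (ψ (c, d')).1 to ℕ using f1 with p
    lift A.edist (ψ (c, d')).1 (ψ (c', d')).1 to ℕ using f2 with q
    generalize B.edist (ψ (c', d')).2 (ψ (c, d')).2 = r at ht ⊢
    cases r with
    | top => simp [← Nat.cast_add] at ht
    | coe r =>
      norm_cast at ht ⊢
      omega
  rw [edist_eq_zero_iff] at hz
  rw [h, hz]

/-- The preimage under `ψ` of the `A`-layer at height `b₀` is closed under corners, hence a box; its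
sides are read off along the layers through any one of its points `(c₀, d₀)`. -/
theorem Iso.snd_eq_iff (ψ : (C □ D) ≃g (A □ B)) (hA : A.Preconnected) {c₀ c : γ} {d₀ d : δ} {b₀ : β}
    (h₀ : (ψ (c₀, d₀)).2 = b₀) :
    (ψ (c, d)).2 = b₀ ↔ (ψ (c, d₀)).2 = b₀ ∧ (ψ (c₀, d)).2 = b₀ := by
  constructor
  · intro h
    exact ⟨(ψ.snd_eq_of_corner hA (h.trans h₀.symm)).trans h,
      (ψ.snd_eq_of_corner hA (h₀.trans h.symm)).trans h₀⟩
  · rintro ⟨h, h'⟩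
    exact (ψ.snd_eq_of_corner hA (h.trans h'.symm)).trans h

/-- The layer of `A □ B` at height `b₀` is carried by an isomorphism to `C □ D` onto the product of
two induced subgraphs, the intersections of its image with the layers through `(c₀, d₀)`. -/
def layerIso (φ : (A □ B) ≃g (C □ D)) (hA : A.Preconnected) {b₀ : β} {c₀ : γ} {d₀ : δ}
    (h₀ : (φ.symm (c₀, d₀)).2 = b₀) :
    A ≃g (C.induce {c | (φ.symm (c, d₀)).2 = b₀} □ D.induce {d | (φ.symm (c₀, d)).2 = b₀}) where
  toFun a :=
    have h := (φ.symm.snd_eq_iff hA (c := (φ (a, b₀)).1) (d := (φ (a, b₀)).2) h₀).mp (by simp)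
    (⟨(φ (a, b₀)).1, h.1⟩, ⟨(φ (a, b₀)).2, h.2⟩)
  invFun x := (φ.symm (x.1.1, x.2.1)).1
  left_inv a := by simp
  right_inv := by
    rintro ⟨⟨c, hc⟩, ⟨d, hd⟩⟩
    have h := (φ.symm.snd_eq_iff hA h₀).mpr ⟨hc, hd⟩
    have h' : φ ((φ.symm (c, d)).1, b₀) = (c, d) := by rw [← h]; simp
    simp [h']
  map_rel_iff' := by
    intro a a'
    have h := φ.map_adj_iff (v := (a, b₀)) (w := (a', b₀))
    rw [boxProd_adj_left] at h
    rw [← h]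
    simp [boxProd_adj, Subtype.ext_iff]

/-- The intersection of an `A`-layer with a `C`-layer is the same graph whether it is regarded as an
induced subgraph of `A` or of `C`. -/
def induceLayerIso (φ : (A □ B) ≃g (C □ D)) (b₀ : β) (d₀ : δ) :
    A.induce {a | (φ (a, b₀)).2 = d₀} ≃g C.induce {c | (φ.symm (c, d₀)).2 = b₀} where
  toFun a := ⟨(φ (a.1, b₀)).1, by
    have h : ((φ (a.1, b₀)).1, d₀) = φ (a.1, b₀) := Prod.ext rfl a.2.symm
    simp [h]⟩
  invFun c := ⟨(φ.symm (c.1, d₀)).1, by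
    have h : ((φ.symm (c.1, d₀)).1, b₀) = φ.symm (c.1, d₀) := Prod.ext rfl c.2.symm
    simp [h]⟩
  left_inv a := by
    have h : ((φ (a.1, b₀)).1, d₀) = φ (a.1, b₀) := Prod.ext rfl a.2.symm
    simp [h]
  right_inv c := by
    have h : ((φ.symm (c.1, d₀)).1, b₀) = φ.symm (c.1, d₀) := Prod.ext rfl c.2.symm
    simp [h]
  map_rel_iff' := by
    rintro ⟨a, ha⟩ ⟨a', ha'⟩
    have h := φ.map_adj_iff (v := (a, b₀)) (w := (a', b₀))
    rw [boxProd_adj_left] at h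
    simp only [Set.mem_ofPred_eq] at ha ha'
    simp [← h, boxProd_adj, ha, ha']

/-- Any two factorizations of a connected graph into two Cartesian factors have a common
refinement. -/
theorem exists_boxProd_refinement {α β γ δ : Type*} {A : SimpleGraph α} {B : SimpleGraph β}
    {C : SimpleGraph γ} {D : SimpleGraph δ} (hA : A.Connected) (hB : B.Connected)
    (hC : C.Connected) (hD : D.Connected) (φ : (A □ B) ≃g (C □ D)) :
    ∃ (U₁ V₁ : Set γ) (U₂ V₂ : Set δ),
      Nonempty (A ≃g (C.induce U₁ □ D.induce U₂)) ∧ Nonempty (B ≃g (C.induce V₁ □ D.induce V₂)) ∧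
      Nonempty (C ≃g (C.induce U₁ □ C.induce V₁)) ∧ Nonempty (D ≃g (D.induce U₂ □ D.induce V₂)) := by
  obtain ⟨a₀⟩ := hA.nonempty
  obtain ⟨b₀⟩ := hB.nonempty
  obtain ⟨c₀, d₀, h₀⟩ : ∃ c₀ d₀, φ (a₀, b₀) = (c₀, d₀) := ⟨_, _, rfl⟩
  have h₀' : φ.symm (c₀, d₀) = (a₀, b₀) := by rw [← h₀]; simp
  -- The same isomorphism with the two factors of its source, its target, or both exchanged.
  let φl : (B □ A) ≃g (C □ D) := (boxProdComm B A).trans φ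
  let φr : (A □ B) ≃g (D □ C) := φ.trans (boxProdComm C D)
  let φlr : (B □ A) ≃g (D □ C) := φl.trans (boxProdComm C D)
  refine ⟨{c | (φ.symm (c, d₀)).2 = b₀}, {c | (φ.symm (c, d₀)).1 = a₀},
    {d | (φ.symm (c₀, d)).2 = b₀}, {d | (φ.symm (c₀, d)).1 = a₀}, ⟨?_⟩, ⟨?_⟩, ⟨?_⟩, ⟨?_⟩⟩
  · exact layerIso φ hA.preconnected (by rw [h₀'])
  · exact layerIso φl hB.preconnected (congrArg Prod.fst h₀')
  · exact (layerIso φ.symm hC.preconnected (congrArg Prod.snd h₀)).trans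
      ((induceLayerIso φ b₀ d₀).boxProd (induceLayerIso φl a₀ d₀))
  · exact (layerIso φr.symm hD.preconnected (congrArg Prod.fst h₀)).trans
      ((induceLayerIso φr b₀ c₀).boxProd (induceLayerIso φlr a₀ c₀))

end Refinement

/-! ### Cartesian factors and prime graphs -/

section Factors

variable {α β γ : Type*} {A : SimpleGraph α} {B : SimpleGraph β}
  {C : SimpleGraph γ}

/-- The product with a one-vertex graph. -/
def boxProdUnique [Unique β] (A : SimpleGraph α) (B : SimpleGraph β) : (A □ B) ≃g A where
  toEquiv := Equiv.prodUnique α β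
  map_rel_iff' := by
    rintro ⟨a, b⟩ ⟨a', b'⟩
    simp [boxProd_adj, Subsingleton.elim b b']

theorem IsCartesianFactor.of_iso [Finite α] [Finite γ] (e : A ≃g (B □ C)) :
    B.IsCartesianFactor A := by
  cases nonempty_fintype γ
  exact ⟨_, C.overFin rfl, ⟨e.trans (Iso.refl.boxProd (C.overFinIso rfl))⟩⟩

theorem IsCartesianFactor.congr_left {β' : Type*} {B' : SimpleGraph β'} [Finite α] (f : B ≃g B')
    (h : B.IsCartesianFactor A) : B'.IsCartesianFactor A := by
  obtain ⟨n, Q, ⟨e⟩⟩ := h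
  exact ⟨n, Q, ⟨e.trans (f.boxProd Iso.refl)⟩⟩

theorem IsCartesianFactor.trans [Finite α] [Finite β] (h : C.IsCartesianFactor B)
    (h' : B.IsCartesianFactor A) : C.IsCartesianFactor A := by
  obtain ⟨n, Q, ⟨e⟩⟩ := h
  obtain ⟨n', Q', ⟨e'⟩⟩ := h'
  exact .of_iso (e'.trans ((e.boxProd Iso.refl).trans (boxProdAssoc C Q Q')))

theorem IsCartesianFactor.card_dvd [Finite α] (h : B.IsCartesianFactor A) :
    Nat.card β ∣ Nat.card α := by
  obtain ⟨n, Q, ⟨e⟩⟩ := h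
  rw [Nat.card_congr e.toEquiv, Nat.card_prod]
  exact dvd_mul_right _ _

/-- A nontrivial factor of a prime graph is the whole graph. -/
theorem IsCartesianPrime.nonempty_iso [Finite α] [Finite β] (hA : A.IsCartesianPrime)
    (h : B.IsCartesianFactor A) (hB : Nontrivial β) : Nonempty (B ≃g A) := by
  cases nonempty_fintype β
  rcases hA.2 _ (B.overFin rfl) (h.congr_left (B.overFinIso rfl)) with h1 | ⟨⟨e⟩⟩
  · exact absurd h1 (Fintype.one_lt_card_iff_nontrivial.mpr hB).ne'
  · exact ⟨(B.overFinIso rfl).trans e⟩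

/-- A nontrivial finite graph has a prime factor: one with the fewest vertices among its nontrivial
factors. -/
theorem exists_isCartesianPrime_factor [Finite α] [Nontrivial α] (A : SimpleGraph α) :
    ∃ (n : ℕ) (P : SimpleGraph (Fin n)), P.IsCartesianPrime ∧ P.IsCartesianFactor A := by
  classical
  cases nonempty_fintype α
  have hex : ∃ n, 1 < n ∧ ∃ P : SimpleGraph (Fin n), P.IsCartesianFactor A := by
    refine ⟨Fintype.card α, Fintype.one_lt_card, A.overFin rfl, ?_⟩
    exact ⟨1, ⊥, ⟨(A.overFinIso rfl).trans (boxProdUnique _ _).symm⟩⟩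
  obtain ⟨hn, P, hP⟩ := Nat.find_spec hex
  refine ⟨Nat.find hex, P, ⟨Fin.nontrivial_iff_two_le.mpr hn, fun m R hR => ?_⟩, hP⟩
  by_cases hm : m = 1
  · exact Or.inl hm
  right
  obtain ⟨k, Q, ⟨e⟩⟩ := hR
  have hcard : Nat.find hex = m * k := by simpa using Nat.card_congr e.toEquiv
  have hm0 : m ≠ 0 := by rintro rfl; omega
  have hk0 : k ≠ 0 := by rintro rfl; omega
  -- `R` is itself a factor of `A`, so it has at least as many vertices as `P`.
  have hmin : Nat.find hex ≤ m :=
    Nat.find_min' hex ⟨by omega, R, IsCartesianFactor.trans ⟨k, Q, ⟨e⟩⟩ hP⟩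
  obtain rfl : k = 1 := by
    by_contra hk
    have : m * 2 ≤ m * k := Nat.mul_le_mul_left m (by omega)
    omega
  exact ⟨(e.trans (boxProdUnique R Q)).symm⟩

/-- Two graphs without a common prime factor have no nontrivial common factor at all. -/
theorem subsingleton_of_common_factor {δ : Type*} {D : SimpleGraph δ} [Finite α] [Finite β]
    [Finite δ]
    (h : ∀ (n : ℕ) (P : SimpleGraph (Fin n)), P.IsCartesianPrime →
      ¬ (P.IsCartesianFactor A ∧ P.IsCartesianFactor B))
    (hA : D.IsCartesianFactor A) (hB : D.IsCartesianFactor B) : Subsingleton δ := by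
  by_contra hδ
  rw [not_subsingleton_iff_nontrivial] at hδ
  obtain ⟨n, P, hP, hPD⟩ := exists_isCartesianPrime_factor D
  exact h n P hP ⟨hPD.trans hA, hPD.trans hB⟩

end Factors

/-! ### Cancellation -/

section Cancellation

variable {α β γ δ : Type*} [Finite α] [Finite β] [Finite γ] [Finite δ] {A : SimpleGraph α}
  {B : SimpleGraph β} {C : SimpleGraph γ} {D : SimpleGraph δ}

/-- If `A` and `D`, and `B` and `C`, have no common prime factor, then an isomorphism between
connected graphs `A □ B` and `C □ D` makes `A` isomorphic to `C` and `B` isomorphic to `D`. -/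
theorem nonempty_iso_of_no_common_prime_factor (hA : A.Connected) (hB : B.Connected)
    (hC : C.Connected) (hD : D.Connected) (φ : (A □ B) ≃g (C □ D))
    (hAD : ∀ (n : ℕ) (P : SimpleGraph (Fin n)), P.IsCartesianPrime →
      ¬ (P.IsCartesianFactor A ∧ P.IsCartesianFactor D))
    (hCB : ∀ (n : ℕ) (P : SimpleGraph (Fin n)), P.IsCartesianPrime →
      ¬ (P.IsCartesianFactor C ∧ P.IsCartesianFactor B)) :
    Nonempty (A ≃g C) ∧ Nonempty (B ≃g D) := by
  obtain ⟨U₁, V₁, U₂, V₂, ⟨eA⟩, ⟨eB⟩, ⟨eC⟩, ⟨eD⟩⟩ := exists_boxProd_refinement hA hB hC hD φ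
  have hU₂ : Subsingleton U₂ := subsingleton_of_common_factor hAD
    (.of_iso (eA.trans (boxProdComm _ _))) (.of_iso eD)
  have hV₁ : Subsingleton V₁ := subsingleton_of_common_factor hCB
    (.of_iso (eC.trans (boxProdComm _ _))) (.of_iso eB)
  obtain ⟨a⟩ := hA.nonempty
  obtain ⟨b⟩ := hB.nonempty
  have : Unique U₂ := _root_.uniqueOfSubsingleton (eA a).2
  have : Unique V₁ := _root_.uniqueOfSubsingleton (eB b).1
  exact ⟨⟨(eA.trans (boxProdUnique _ _)).trans (eC.trans (boxProdUnique _ _)).symm⟩,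
    ⟨(eB.trans ((boxProdComm _ _).trans (boxProdUnique _ _))).trans
      (eD.trans ((boxProdComm _ _).trans (boxProdUnique _ _))).symm⟩⟩

/-- A prime factor of a prime graph is isomorphic to it, so non-isomorphic prime graphs share none. -/
theorem IsCartesianPrime.not_common_factor (hA : A.IsCartesianPrime) (hB : B.IsCartesianPrime)
    (hAB : IsEmpty (A ≃g B)) (n : ℕ) (P : SimpleGraph (Fin n)) (hP : P.IsCartesianPrime) :
    ¬ (P.IsCartesianFactor A ∧ P.IsCartesianFactor B) := by
  rintro ⟨hPA, hPB⟩
  obtain ⟨e⟩ := hA.nonempty_iso hPA hP.1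
  obtain ⟨f⟩ := hB.nonempty_iso hPB hP.1
  exact hAB.false (e.symm.trans f)

end Cancellation

theorem not_common_factor_of_coprime_card {α β : Type*} [Finite α] [Finite β] {A : SimpleGraph α}
    {B : SimpleGraph β} (h : Nat.gcd (Nat.card α) (Nat.card β) = 1) (n : ℕ)
    (P : SimpleGraph (Fin n)) (hP : P.IsCartesianPrime) :
    ¬ (P.IsCartesianFactor A ∧ P.IsCartesianFactor B) := by
  rintro ⟨hPA, hPB⟩
  have h1 := Nat.dvd_gcd hPA.card_dvd hPB.card_dvd
  rw [h, Nat.card_fin, Nat.dvd_one] at h1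
  have := Fin.nontrivial_iff_two_le.mp hP.1
  omega

end SimpleGraph

theorem theorem1 (M : SimpleGraph.MatrixRep) {p q : ℕ}
    {V : Fin p → Type*} {W : Fin q → Type*}
    [∀ i, Fintype (V i)] [∀ j, Fintype (W j)]
    (G : ∀ i, SimpleGraph (V i)) (H : ∀ j, SimpleGraph (W j))
    (hG : SimpleGraph.IsConnectedCospectralFamily M G)
    (hH : SimpleGraph.IsConnectedCospectralFamily M H)
    (hne : ∀ i j, (G i).graphSpectrum M ≠ (H j).graphSpectrum M)
    (hcond :
      ((∀ i, (G i).IsCartesianPrime) ∧ (∀ j, (H j).IsCartesianPrime)) ∨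
      (∀ i j, Nat.gcd (Fintype.card (V i)) (Fintype.card (W j)) = 1) ∨
      (∀ (n : ℕ) (P : SimpleGraph (Fin n)), P.IsCartesianPrime →
        ¬ ∃ i j, P.IsCartesianFactor (G i) ∧ P.IsCartesianFactor (H j))) :
    SimpleGraph.IsConnectedCospectralFamily M
      (fun k : Fin p × Fin q => (G k.1) □ (H k.2)) := by
  -- Each of the three conditions excludes common prime factors of a `G i` and an `H j`.
  have hcop : ∀ i j (n : ℕ) (P : SimpleGraph (Fin n)), P.IsCartesianPrime →
      ¬ (P.IsCartesianFactor (G i) ∧ P.IsCartesianFactor (H j)) := by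
    intro i j
    rcases hcond with ⟨hGp, hHp⟩ | hgcd | hfac
    · exact (hGp i).not_common_factor (hHp j) ⟨fun e => hne i j (e.graphSpectrum_eq M)⟩
    · exact SimpleGraph.not_common_factor_of_coprime_card
        (by simpa only [Nat.card_eq_fintype_card] using hgcd i j)
    · exact fun n P hP h => hfac n P hP ⟨i, j, h⟩
  refine ⟨fun k => (hG.1 k.1).boxProd (hH.1 k.2), fun k l hkl => ⟨?_, ?_⟩⟩
  · have h1 : (G k.1).graphSpectrum M = (G l.1).graphSpectrum M := by
      by_cases h : k.1 = l.1
      · rw [h]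
      · exact (hG.2 h).1
    have h2 : (H k.2).graphSpectrum M = (H l.2).graphSpectrum M := by
      by_cases h : k.2 = l.2
      · rw [h]
      · exact (hH.2 h).1
    rw [SimpleGraph.graphSpectrum_boxProd, SimpleGraph.graphSpectrum_boxProd, h1, h2]
  · rintro ⟨φ⟩
    obtain ⟨h1, h2⟩ := SimpleGraph.nonempty_iso_of_no_common_prime_factor (hG.1 k.1) (hH.1 k.2)
      (hG.1 l.1) (hH.1 l.2) φ (hcop k.1 l.2) (hcop l.1 k.2)
    refine hkl (Prod.ext ?_ ?_)
    · by_contra h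
      exact (hG.2 h).2 h1
    · by_contra h
      exact (hH.2 h).2 h2
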